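/- Let $\mu=\{\mu_n\}_{n\ge 1}$ be a sequence of non-negative real numbers, not all zero, with $\mu_n\to 0$ as $n\to\infty$, and let $\mu_*=\max_n\mu_n$. Let $$\mathcal E_\mu=\Big\{x\in\ell^2 : x_n=0 \text{ if } \mu_n=0,\ \sum_{n:\mu_n>0}|x_n/\mu_n|^2\le 1\Big\}.$$ For $\varepsilon>0$ let $M_\mu(\varepsilon)=|\{n:\mu_n\ge\varepsilon\}|$ and $I_\tau(\varepsilon)=\int_\varepsilon^\infty M_\mu(u)\,u^{-\tau}\,du$. For $\sigma>0$ consider the Gaussian sequence model $y_n=x_n+\sigma\xi_n$, $n\ge 1$, with $x\in\mathcal E_\mu$ and $\xi_n$ independent standard normal. An estimator is a measurable map $\hat x:\mathbb R^{\mathbb N^*}\to\ell^2$; it is linear if there are coefficients $(c_n)$ with $\hat x(y)=(c_ny_n)_n$ (almost surely under the law of $y$, for every $x\in\mathcal E_\mu$). Let $$R_\sigma=\inf_{\hat x}\sup_{x\in\mathcal E_\mu}\mathbb E\,\|\hat x(y)-x\|_2^2,\qquad R_\sigma^L=\inf_{\hat x\text{ linear}}\ \sup_{x\in\mathcal E_\mu}\mathbb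 E\,\|\hat x(y)-x\|_2^2$$ be the minimax risk and the linear minimax risk. Let $W$ denote the (principal branch of the) Lambert W function. Then for every $\sigma>0$ the equation $\sigma^2\big(2I_3(\varepsilon)-I_2(\varepsilon)/\varepsilon\big)=1$ has a unique solution $\varepsilon=\varepsilon_\sigma>0$ (the critical radius), $R_\sigma<\infty$, $0<R_\sigma^L<\infty$, and $$\left|\frac{R_\sigma}{R_\sigma^L}-1\right|\le\frac{4\sqrt2\,\sigma}{\varepsilon_\sigma}\sqrt{W\!\left(\left(\frac{(1+\sqrt3)\,\mu_*^2\,\varepsilon_\sigma}{\sqrt2\,\sigma R_\sigma^L}\right)^{2}\right)}.$$ Moreover, with $v_\sigma=\varepsilon_\sigma/(\sigma R_\sigma^L)$, one has $v_\sigma\to\infty$ as $\sigma\to0^+$ and, as a consequence, $$R_\sigma=R_\sigma^L+O\!\left(\frac{\sqrt{\ln v_\sigma}}{v_\sigma}\right)\quad\text{as }\sigma\to0^+.$$ -/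

import Mathlib

open Set Filter Topology MeasureTheory ProbabilityTheory Asymptotics
open scoped ENNReal

namespace EllipsoidRisk

noncomputable section

/-- The Hilbert space of real square-summable sequences. The sequences are indexed by `ℕ` instead
of by the positive integers; this is only a relabelling of the coordinates. -/
abbrev SqSum : Type := lp (fun _ : ℕ => ℝ) 2

/-- The ellipsoid with semi-axes `μ n`: the square-summable `x` with `x n = 0` whenever `μ n = 0`
and with `∑ |x n / μ n| ^ 2 ≤ 1` over the indices with `μ n > 0`. The sum is taken in `[0, ∞]`. -/
def ellipsoid (μ : ℕ → ℝ) : Set SqSum :=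
  {x | (∀ n, μ n = 0 → x n = 0) ∧
    ∑' n : {n : ℕ // 0 < μ n}, ENNReal.ofReal (|x n / μ n| ^ 2) ≤ 1}

/-- The semi-axis-counting function: the number of `n` with `μ n ≥ ε`
(a finite number for `ε > 0` when `μ` tends to zero). -/
def countAxes (μ : ℕ → ℝ) (ε : ℝ) : ℝ :=
  ({n : ℕ | ε ≤ μ n}.ncard : ℝ)

/-- The type-`τ` integral `∫_ε^∞ M(u) / u ^ τ du` of the semi-axis-counting function `M`. -/
def typeIntegral (μ : ℕ → ℝ) (τ : ℝ) (ε : ℝ) : ℝ :=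
  ∫ u in Ioi ε, countAxes μ u / u ^ τ

/-- `ε > 0` solves the critical radius equation `σ² (2 I₃(ε) - I₂(ε) / ε) = 1`. -/
def IsCriticalRadius (μ : ℕ → ℝ) (σ ε : ℝ) : Prop :=
  0 < ε ∧ σ ^ 2 * (2 * typeIntegral μ 3 ε - typeIntegral μ 2 ε / ε) = 1

/-- The critical radius: the solution `ε > 0` of the critical radius equation. -/
def criticalRadius (μ : ℕ → ℝ) (σ : ℝ) : ℝ :=
  Classical.epsilon (IsCriticalRadius μ σ)

/-- The law of the noise: independent standard normal coordinates. -/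
def noise : Measure (ℕ → ℝ) :=
  Measure.infinitePi (fun _ : ℕ => gaussianReal 0 1)

/-- The observation `y = x + σ ξ`. -/
def observation (σ : ℝ) (x : SqSum) (ξ : ℕ → ℝ) : ℕ → ℝ :=
  fun n => x n + σ * ξ n

/-- An estimator is a map from sequences (product σ-algebra) to square-summable sequences
(Borel σ-algebra of the norm) that is measurable. -/
def IsEstimator (f : (ℕ → ℝ) → SqSum) : Prop :=
  @Measurable (ℕ → ℝ) SqSum MeasurableSpace.pi (borel SqSum) f

/-- An estimator `f` is linear for the model with parameter set `K` and noise level `σ` if there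
are coefficients `c` with `f(y) = (c n * y n)_n`, almost surely under each law of `y` in the model.
(For square-summable `c` with infinitely many non-zero terms, `(c n * y n)_n` is square-summable
only almost surely.) -/
def IsLinearEstimator (K : Set SqSum) (σ : ℝ) (f : (ℕ → ℝ) → SqSum) : Prop :=
  IsEstimator f ∧ ∃ c : ℕ → ℝ, ∀ x ∈ K, ∀ᵐ ξ ∂noise, ∀ n,
    f (observation σ x ξ) n = c n * observation σ x ξ n

/-- The mean squared error of `f` at the parameter `x`, as an element of `[0, ∞]`. -/
def mse (σ : ℝ) (x : SqSum) (f : (ℕ → ℝ) → SqSum) : ℝ≥0∞ :=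
  ∫⁻ ξ, ENNReal.ofReal (‖f (observation σ x ξ) - x‖ ^ 2) ∂noise

/-- The minimax risk over `K` at noise level `σ`, as an element of `[0, ∞]`. -/
def minimaxRisk (σ : ℝ) (K : Set SqSum) : ℝ≥0∞ :=
  ⨅ (f : (ℕ → ℝ) → SqSum) (_ : IsEstimator f), ⨆ x ∈ K, mse σ x f

/-- The linear minimax risk over `K` at noise level `σ`, as an element of `[0, ∞]`. -/
def linearMinimaxRisk (σ : ℝ) (K : Set SqSum) : ℝ≥0∞ :=
  ⨅ (f : (ℕ → ℝ) → SqSum) (_ : IsLinearEstimator K σ f), ⨆ x ∈ K, mse σ x f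

/-- The principal branch of the Lambert W function: for `x ≥ -1/e`, the `w ≥ -1` such that
`w * exp w = x`. -/
def lambertW (x : ℝ) : ℝ :=
  Function.invFunOn (fun w : ℝ => w * Real.exp w) (Ici (-1)) x

/-- The minimax risk of the ellipsoid, as a real number. -/
def risk (μ : ℕ → ℝ) (σ : ℝ) : ℝ := (minimaxRisk σ (ellipsoid μ)).toReal

/-- The linear minimax risk of the ellipsoid, as a real number. -/
def linearRisk (μ : ℕ → ℝ) (σ : ℝ) : ℝ := (linearMinimaxRisk σ (ellipsoid μ)).toReal

/-- The largest semi-axis (the supremum is a maximum for a non-negative null sequence). -/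
def maxAxis (μ : ℕ → ℝ) : ℝ := ⨆ n, μ n

/-- The quantity `v_σ = ε_σ / (σ R^L_σ)`. -/
def vScale (μ : ℕ → ℝ) (σ : ℝ) : ℝ := criticalRadius μ σ / (σ * linearRisk μ σ)

end

end EllipsoidRisk

/-!
The linear problem is solved by Pinsker's saddle point. Integrating the counting function turns the
critical radius equation into `σ² ∑ (1/μ n) (1/ε - 1/μ n)₊ = 1`, whose left-hand side is continuous
and strictly decreasing where it is positive (`existsUnique_isCriticalRadius`). The linear estimator
with coefficients `(1 - ε/μ n)₊` has worst-case risk `σ² ∑ (1 - ε/μ n)₊`, and the parameter with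
squared coordinates `b n² = σ² (μ n/ε - 1)₊` lies on the boundary of the ellipsoid, precisely by the
critical radius equation, and forces the same risk on every linear estimator
(`linearMinimaxRisk_ellipsoid_eq`). The sum runs over the finitely many semi-axes longer than `ε`.

For the lower bound on the minimax risk, let the parameter be random with independent coordinates
`N(0, (1 - η) b n²)`. Its Bayes risk is at least `(1 - η)` times the linear risk
(`bayes_coordinate_lower_bound`, by rotation invariance of the Gaussian law). The prior charges the
complement of the ellipsoid, but an estimator may be truncated to the ball that contains the
ellipsoid, and the contribution of the complement is then at most
`4 μ_*² E exp (l (Q - 1))`, where `Q = ∑ (x n/μ n)²` has mean `1 - η`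
(`bayes_le_minimaxRisk`). Each weight in `Q` is at most `σ²/(4 ε²)`, so the Chernoff exponent
`l = η ε²/σ²` gives `exp (-η² ε²/(2 σ²))` (`lintegral_exp_prior_le`). The choice
`η = 2 √2 (σ/ε) √W` balances this term against the loss `η` (`abs_ratio_sub_one_le`); that is where
the Lambert function enters.

The asymptotic statements follow from `R^L ≤ μ_* ε`, which gives `v ≥ 1/(μ_* σ)`, and from
`W(x) ≤ log x` for `x ≥ e`.
-/

namespace EllipsoidRisk

/-! ### Gaussian noise: rotation invariance, the Bayes risk of one coordinate, exponential moments -/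

instance : IsProbabilityMeasure noise := by unfold noise; infer_instance

/-- A sequence of independent Gaussian pairs is a pair of independent noise sequences. -/
theorem map_unzip_infinitePi_prod :
    (Measure.infinitePi fun _ : ℕ => (gaussianReal 0 1).prod (gaussianReal 0 1)).map
      (fun p => ((fun n => (p n).1, fun n => (p n).2) : (ℕ → ℝ) × (ℕ → ℝ))) =
        noise.prod noise := by
  classical
  have huniv : (univ : Set (ℕ → ℝ)) ∈
      squareCylinders (fun _ : ℕ => {s : Set ℝ | MeasurableSet s}) :=
    ⟨∅, fun _ => univ, by simp, by simp⟩
  have hpi : IsPiSystem (squareCylinders (fun _ : ℕ => {s : Set ℝ | MeasurableSet s})) :=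
    isPiSystem_squareCylinders (fun _ => MeasurableSpace.isPiSystem_measurableSet)
      (fun _ => MeasurableSet.univ (α := ℝ))
  have hspan : noise.FiniteSpanningSetsIn
      (squareCylinders (fun _ : ℕ => {s : Set ℝ | MeasurableSet s})) :=
    { set := fun _ => univ
      set_mem := fun _ => huniv
      finite := fun _ => measure_lt_top _ _
      spanning := iUnion_const _ }
  refine (Measure.prod_eq_generateFrom generateFrom_squareCylinders generateFrom_squareCylinders
    hpi hpi hspan hspan ?_).symm
  rintro _ ⟨s, a, ha, rfl⟩ _ ⟨t, b, hb, rfl⟩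
  have ha' : ∀ i, MeasurableSet (a i) := fun i => ha i trivial
  have hb' : ∀ i, MeasurableSet (b i) := fun i => hb i trivial
  rw [Measure.map_apply (by fun_prop) ((MeasurableSet.pi s.countable_toSet fun i _ => ha' i).prod
    (MeasurableSet.pi t.countable_toSet fun i _ => hb' i))]
  have hpre : (fun p : ℕ → ℝ × ℝ => ((fun n => (p n).1, fun n => (p n).2) :
      (ℕ → ℝ) × (ℕ → ℝ))) ⁻¹' ((s : Set ℕ).pi a ×ˢ (t : Set ℕ).pi b) =
      ((s ∪ t : Finset ℕ) : Set ℕ).pi fun n =>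
        (if n ∈ s then a n else univ) ×ˢ (if n ∈ t then b n else univ) := by
    ext p
    simp only [mem_preimage, mem_prod, Set.mem_pi, Finset.mem_coe, Finset.mem_union]
    constructor
    · rintro ⟨h1, h2⟩ i -
      constructor
      · split_ifs with h
        · exact h1 i h
        · trivial
      · split_ifs with h
        · exact h2 i h
        · trivial
    · intro h
      refine ⟨fun i hi => ?_, fun i hi => ?_⟩
      · simpa [hi] using (h i (Or.inl hi)).1
      · simpa [hi] using (h i (Or.inr hi)).2
  rw [hpre, Measure.infinitePi_pi]
  · simp_rw [Measure.prod_prod]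
    rw [Finset.prod_mul_distrib, noise, Measure.infinitePi_pi _ fun i _ => ha' i,
      Measure.infinitePi_pi _ fun i _ => hb' i]
    congr 1
    · rw [← Finset.prod_subset (Finset.subset_union_left : s ⊆ s ∪ t)]
      · exact Finset.prod_congr rfl fun i hi => by simp [hi]
      · intro i _ hi; simp [hi]
    · rw [← Finset.prod_subset (Finset.subset_union_right : t ⊆ s ∪ t)]
      · exact Finset.prod_congr rfl fun i hi => by simp [hi]
      · intro i _ hi; simp [hi]
  · intro i _
    refine MeasurableSet.prod ?_ ?_ <;> split_ifs <;> simp [ha', hb']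

/-- Two independent copies of the noise may be rotated by a different angle in each coordinate. -/
theorem measurePreserving_rotate_noise (θ : ℕ → ℝ) :
    MeasurePreserving (fun p : (ℕ → ℝ) × (ℕ → ℝ) =>
      ((fun n => Real.cos (θ n) * p.1 n + Real.sin (θ n) * p.2 n,
        fun n => -Real.sin (θ n) * p.1 n + Real.cos (θ n) * p.2 n) : (ℕ → ℝ) × (ℕ → ℝ)))
      (noise.prod noise) (noise.prod noise) := by
  refine ⟨by fun_prop, ?_⟩
  conv_lhs => rw [← map_unzip_infinitePi_prod]
  rw [Measure.map_map (by fun_prop) (by fun_prop)]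
  have hrot : ∀ t : ℝ, ((gaussianReal 0 1).prod (gaussianReal 0 1)).map
      (fun q : ℝ × ℝ => ContinuousLinearMap.rotation t q) =
        (gaussianReal 0 1).prod (gaussianReal 0 1) := fun t =>
    IsGaussian.map_rotation_eq_self (by simp) t
  have hP := Measure.infinitePi_map_pi
    (fun _ : ℕ => (gaussianReal 0 1).prod (gaussianReal 0 1))
    (f := fun n q => ContinuousLinearMap.rotation (θ n) q) (fun n => by fun_prop)
  simp_rw [hrot] at hP
  conv_rhs => rw [← map_unzip_infinitePi_prod, ← hP]
  rw [Measure.map_map (by fun_prop) (by fun_prop)]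
  congr 1

theorem integrable_affine_sq_gaussian (a b : ℝ) :
    Integrable (fun x : ℝ => (a + b * x) ^ 2) (gaussianReal 0 1) := by
  have h := (memLp_id_gaussianReal (μ := 0) (v := 1) 2)
  exact ((memLp_const a).add (h.const_mul b)).integrable_sq

theorem integral_affine_sq_gaussian (a b : ℝ) :
    ∫ x, (a + b * x) ^ 2 ∂(gaussianReal 0 1) = a ^ 2 + b ^ 2 := by
  have h := (memLp_id_gaussianReal (μ := 0) (v := 1) 2)
  have h1 : Integrable (fun x : ℝ => x) (gaussianReal 0 1) := h.integrable (by norm_num)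
  have h2 : Integrable (fun x : ℝ => x ^ 2) (gaussianReal 0 1) := h.integrable_sq
  have hv : ∫ x, x ^ 2 ∂(gaussianReal 0 1) = 1 := by
    have := variance_fun_id_gaussianReal (μ := 0) (v := 1)
    rw [variance_of_integral_eq_zero (by fun_prop) (by simp)] at this
    simpa using this
  have : (fun x : ℝ => (a + b * x) ^ 2) = fun x => a ^ 2 + (2 * a * b) * x + b ^ 2 * x ^ 2 := by
    ext x; ring
  have h12 : Integrable (fun x : ℝ => a ^ 2 + (2 * a * b) * x) (gaussianReal 0 1) :=
    (integrable_const _).add (h1.const_mul _)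
  rw [this, integral_add h12 (h2.const_mul _),
    integral_add (integrable_const _) (h1.const_mul _),
    integral_const_mul, integral_const_mul, hv]
  simp

theorem lintegral_affine_sq_noise (n : ℕ) (a b : ℝ) :
    ∫⁻ v, ENNReal.ofReal ((a + b * v n) ^ 2) ∂noise = ENNReal.ofReal (a ^ 2 + b ^ 2) := by
  have hm : Measurable fun x : ℝ => ENNReal.ofReal ((a + b * x) ^ 2) := by fun_prop
  have h := (measurePreserving_eval_infinitePi (fun _ : ℕ => gaussianReal 0 1) n).lintegral_comp hm
  rw [← integral_affine_sq_gaussian a b, ofReal_integral_eq_lintegral_ofReal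
    (integrable_affine_sq_gaussian a b) (ae_of_all _ fun x => sq_nonneg _), ← h]
  rfl

/-- For the Gaussian prior `x k = τ k * g k`, no function `φ` of the whole observation `y` estimates
the coordinate `x n` better than the posterior mean does. The pair `(g, ξ)` is rotated in each
coordinate so that `y` depends on the first component `u` only; then `x n` is a function of `u n`
plus an independent Gaussian whose variance is the bound. -/
theorem bayes_coordinate_lower_bound {σ : ℝ} (hσ : 0 < σ) (τ : ℕ → ℝ) (n : ℕ)
    {φ : (ℕ → ℝ) → ℝ} (hφ : Measurable φ) :
    ENNReal.ofReal (τ n ^ 2 * σ ^ 2 / (τ n ^ 2 + σ ^ 2)) ≤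
      ∫⁻ g, ∫⁻ ξ, ENNReal.ofReal ((φ (fun k => τ k * g k + σ * ξ k) - τ n * g n) ^ 2)
        ∂noise ∂noise := by
  set ρ : ℕ → ℝ := fun k => √(τ k ^ 2 + σ ^ 2) with hρ
  have hρpos : ∀ k, 0 < ρ k := fun k => Real.sqrt_pos.2 (by positivity)
  have hρsq : ∀ k, ρ k ^ 2 = τ k ^ 2 + σ ^ 2 := fun k => Real.sq_sqrt (by positivity)
  -- The angle for which `y k` is the first rotated coordinate, up to the factor `ρ k`.
  have hangle : ∀ k, ∃ t, Real.cos t = τ k / ρ k ∧ Real.sin t = -(σ / ρ k) := by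
    intro k
    have hz : ‖(⟨τ k / ρ k, -(σ / ρ k)⟩ : ℂ)‖ = 1 := by
      rw [← sq_eq_sq₀ (norm_nonneg _) (by norm_num), ← Complex.normSq_eq_norm_sq,
        Complex.normSq_mk]
      have := (hρpos k).ne'
      field_simp
      linarith [hρsq k]
    have hne : (⟨τ k / ρ k, -(σ / ρ k)⟩ : ℂ) ≠ 0 := by
      intro h; rw [h] at hz; simp at hz
    exact ⟨Complex.arg ⟨τ k / ρ k, -(σ / ρ k)⟩, by rw [Complex.cos_arg hne, hz]; simp,
      by rw [Complex.sin_arg, hz]; simp⟩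
  choose θ hcos hsin using hangle
  have hmeas : Measurable fun p : (ℕ → ℝ) × (ℕ → ℝ) =>
      ENNReal.ofReal ((φ (fun k => τ k * p.1 k + σ * p.2 k) - τ n * p.1 n) ^ 2) := by
    fun_prop
  rw [← lintegral_prod _ hmeas.aemeasurable,
    ← (measurePreserving_rotate_noise θ).lintegral_comp hmeas,
    lintegral_prod _ (by fun_prop)]
  have hinner : ∀ u : ℕ → ℝ, ENNReal.ofReal (τ n ^ 2 * σ ^ 2 / (τ n ^ 2 + σ ^ 2)) ≤
      ∫⁻ v, ENNReal.ofReal ((φ (fun k => τ k * (Real.cos (θ k) * u k + Real.sin (θ k) * v k) +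
        σ * (-Real.sin (θ k) * u k + Real.cos (θ k) * v k)) -
          τ n * (Real.cos (θ n) * u n + Real.sin (θ n) * v n)) ^ 2) ∂noise := by
    intro u
    have heq : ∀ v : ℕ → ℝ, (φ (fun k => τ k * (Real.cos (θ k) * u k + Real.sin (θ k) * v k) +
        σ * (-Real.sin (θ k) * u k + Real.cos (θ k) * v k)) -
          τ n * (Real.cos (θ n) * u n + Real.sin (θ n) * v n)) ^ 2 =
        ((φ (fun k => ρ k * u k) - τ n * (τ n / ρ n) * u n) + (τ n * (σ / ρ n)) * v n) ^ 2 := by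
      intro v
      have hy : (fun k => τ k * (Real.cos (θ k) * u k + Real.sin (θ k) * v k) +
          σ * (-Real.sin (θ k) * u k + Real.cos (θ k) * v k)) = fun k => ρ k * u k := by
        ext k
        have := (hρpos k).ne'
        rw [hcos, hsin]
        field_simp
        rw [hρsq]; ring
      rw [hy, hcos, hsin]; ring
    simp_rw [heq]
    rw [lintegral_affine_sq_noise]
    apply ENNReal.ofReal_le_ofReal
    have : τ n ^ 2 * σ ^ 2 / (τ n ^ 2 + σ ^ 2) = (τ n * (σ / ρ n)) ^ 2 := by
      rw [← hρsq]; ring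
    rw [this]
    exact le_add_of_nonneg_left (sq_nonneg _)
  calc _ = ∫⁻ _ : ℕ → ℝ, ENNReal.ofReal (τ n ^ 2 * σ ^ 2 / (τ n ^ 2 + σ ^ 2)) ∂noise := by simp
    _ ≤ _ := lintegral_mono hinner

/-- The exponential moment of a squared standard Gaussian is `(1 - 2 θ) ^ (-1/2)`; near `θ = 0` it
is at most `exp (θ + 2 θ ^ 2)`. -/
theorem one_div_sqrt_le_exp {θ : ℝ} (h0 : 0 ≤ θ) (h1 : θ ≤ 1 / 4) :
    1 / √(1 - 2 * θ) ≤ Real.exp (θ + 2 * θ ^ 2) := by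
  have hpos : 0 < 1 - 2 * θ := by linarith
  have hexp : 1 ≤ (1 - 2 * θ) * Real.exp (2 * θ + 4 * θ ^ 2) := by
    have h := Real.quadratic_le_exp_of_nonneg (x := 2 * θ + 4 * θ ^ 2) (by positivity)
    refine le_trans ?_ (mul_le_mul_of_nonneg_left h hpos.le)
    have h2 : 0 ≤ θ ^ 2 * ((1 - 2 * θ) * (1 + 2 * θ) ^ 2 - 4 * θ) := by
      refine mul_nonneg (sq_nonneg _) ?_
      nlinarith [mul_nonneg h0 (sub_nonneg.2 h1), mul_nonneg (sq_nonneg θ) (sub_nonneg.2 h1)]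
    nlinarith [h2]
  rw [div_le_iff₀ (Real.sqrt_pos.2 hpos)]
  have : Real.exp (θ + 2 * θ ^ 2) = √(Real.exp (2 * θ + 4 * θ ^ 2)) := by
    rw [← Real.exp_half]; ring_nf
  rw [this, ← Real.sqrt_mul (Real.exp_pos _).le, Real.one_le_sqrt]
  linarith

theorem lintegral_exp_sq_gaussian_le {θ : ℝ} (h0 : 0 ≤ θ) (h1 : θ ≤ 1 / 4) :
    ∫⁻ x, ENNReal.ofReal (Real.exp (θ * x ^ 2)) ∂(gaussianReal 0 1) ≤
      ENNReal.ofReal (Real.exp (θ + 2 * θ ^ 2)) := by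
  have hb : 0 < 1 / 2 - θ := by linarith
  rw [gaussianReal_of_var_ne_zero _ one_ne_zero,
    lintegral_withDensity_eq_lintegral_mul _ (measurable_gaussianPDF _ _) (by fun_prop)]
  have heq : ∀ x : ℝ, (gaussianPDF 0 1 * fun x => ENNReal.ofReal (Real.exp (θ * x ^ 2))) x =
      ENNReal.ofReal ((√(2 * Real.pi))⁻¹ * Real.exp (-(1 / 2 - θ) * x ^ 2)) := by
    intro x
    rw [Pi.mul_apply, gaussianPDF, ← ENNReal.ofReal_mul (gaussianPDFReal_nonneg _ _ _),
      gaussianPDFReal, mul_assoc, ← Real.exp_add]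
    simp only [NNReal.coe_one, mul_one, sub_zero]
    ring_nf
  simp_rw [heq]
  rw [← ofReal_integral_eq_lintegral_ofReal ((integrable_exp_neg_mul_sq hb).const_mul _)
    (ae_of_all _ fun x => by positivity), integral_const_mul, integral_gaussian]
  apply ENNReal.ofReal_le_ofReal
  refine le_trans (le_of_eq ?_) (one_div_sqrt_le_exp h0 h1)
  rw [← Real.sqrt_inv, ← Real.sqrt_mul (by positivity), one_div (√_), ← Real.sqrt_inv]
  congr 1
  have : 1 - 2 * θ ≠ 0 := by linarith
  have : 1 / 2 - θ ≠ 0 := hb.ne'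
  have := Real.pi_pos.ne'
  rw [show 1 - 2 * θ = 2 * (1 / 2 - θ) by ring]
  field_simp

theorem lintegral_exp_quadratic_noise_le (S : Finset ℕ) (θ : ℕ → ℝ) (h0 : ∀ n ∈ S, 0 ≤ θ n)
    (h1 : ∀ n ∈ S, θ n ≤ 1 / 4) :
    ∫⁻ g, ENNReal.ofReal (Real.exp (∑ n ∈ S, θ n * g n ^ 2)) ∂noise ≤
      ENNReal.ofReal (Real.exp (∑ n ∈ S, (θ n + 2 * θ n ^ 2))) := by
  have hind : iIndepFun (fun n (g : ℕ → ℝ) => ENNReal.ofReal (Real.exp (θ n * g n ^ 2))) noise :=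
    iIndepFun_infinitePi (P := fun _ : ℕ => gaussianReal 0 1)
      (X := fun n x => ENNReal.ofReal (Real.exp (θ n * x ^ 2))) fun n => by fun_prop
  have hl : ∀ g : ℕ → ℝ, ENNReal.ofReal (Real.exp (∑ n ∈ S, θ n * g n ^ 2)) =
      ∏ n ∈ S, ENNReal.ofReal (Real.exp (θ n * g n ^ 2)) := fun g => by
    rw [Real.exp_sum, ENNReal.ofReal_prod_of_nonneg fun _ _ => (Real.exp_pos _).le]
  simp_rw [hl]
  rw [lintegral_prod_eq_prod_lintegral_of_indepFun S _ hind fun n => by fun_prop, Real.exp_sum,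
    ENNReal.ofReal_prod_of_nonneg fun _ _ => (Real.exp_pos _).le]
  refine Finset.prod_le_prod' fun n hn => ?_
  have hm : Measurable fun x : ℝ => ENNReal.ofReal (Real.exp (θ n * x ^ 2)) := by fun_prop
  have h := (measurePreserving_eval_infinitePi (fun _ : ℕ => gaussianReal 0 1) n).lintegral_comp hm
  exact h.trans_le (lintegral_exp_sq_gaussian_le (h0 n hn) (h1 n hn))

/-! ### Square-summable sequences, the ellipsoid, and the mean squared error by coordinates -/

/-- The finitely supported sequence with entries `a n` for `n ∈ S` and `0` elsewhere. -/
noncomputable def finiteSeq (S : Finset ℕ) (a : ℕ → ℝ) : SqSum :=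
  ∑ n ∈ S, lp.single 2 n (a n)

theorem finiteSeq_apply (S : Finset ℕ) (a : ℕ → ℝ) (k : ℕ) :
    finiteSeq S a k = if k ∈ S then a k else 0 := by
  simp only [finiteSeq, lp.coeFn_sum, Finset.sum_apply, lp.coeFn_single, Finset.sum_pi_single]

theorem ofReal_norm_sq_eq_tsum (x : SqSum) :
    ENNReal.ofReal (‖x‖ ^ 2) = ∑' n, ENNReal.ofReal (x n ^ 2) := by
  have h := lp.hasSum_norm (p := 2) (by norm_num) x
  simp only [ENNReal.toReal_ofNat, Real.rpow_ofNat, Real.norm_eq_abs, sq_abs] at h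
  rw [← h.tsum_eq, ENNReal.ofReal_tsum_of_nonneg (fun n => sq_nonneg _) h.summable]

theorem sum_ofReal_sq_le_ofReal_norm_sq (S : Finset ℕ) (x : SqSum) :
    ∑ n ∈ S, ENNReal.ofReal (x n ^ 2) ≤ ENNReal.ofReal (‖x‖ ^ 2) :=
  (ENNReal.sum_le_tsum S).trans_eq (ofReal_norm_sq_eq_tsum x).symm

theorem tsum_subtype_eq_tsum {μ : ℕ → ℝ} (hμ : ∀ n, 0 ≤ μ n) (x : SqSum) :
    ∑' n : {n : ℕ // 0 < μ n}, ENNReal.ofReal (|x n / μ n| ^ 2) =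
      ∑' n, ENNReal.ofReal ((x n / μ n) ^ 2) := by
  simp_rw [sq_abs]
  refine tsum_subtype_eq_of_support_subset (s := {n | 0 < μ n})
    (f := fun n => ENNReal.ofReal ((x n / μ n) ^ 2)) fun n hn => ?_
  -- Outside the subtype `μ n = 0`, and the junk value `x n / 0 = 0` makes the term vanish.
  refine (hμ n).lt_of_ne fun h => hn ?_
  simp [← h]

theorem norm_sq_le_of_mem_ellipsoid {μ : ℕ → ℝ} (hμ : ∀ n, 0 ≤ μ n) {M : ℝ} (hM : ∀ n, μ n ≤ M)
    {x : SqSum} (hx : x ∈ ellipsoid μ) : ‖x‖ ^ 2 ≤ M ^ 2 := by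
  rw [← ENNReal.ofReal_le_ofReal_iff (sq_nonneg _), ofReal_norm_sq_eq_tsum]
  have hx2 := hx.2
  rw [tsum_subtype_eq_tsum hμ] at hx2
  calc ∑' n, ENNReal.ofReal (x n ^ 2)
      ≤ ∑' n, ENNReal.ofReal (M ^ 2) * ENNReal.ofReal ((x n / μ n) ^ 2) := by
        refine ENNReal.tsum_le_tsum fun n => ?_
        rw [← ENNReal.ofReal_mul (sq_nonneg _)]
        apply ENNReal.ofReal_le_ofReal
        rcases (hμ n).eq_or_lt with h | h
        · simp [hx.1 n h.symm]
        · have : x n = μ n * (x n / μ n) := by field_simp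
          conv_lhs => rw [this, mul_pow]
          have := hM n
          gcongr
    _ = ENNReal.ofReal (M ^ 2) * ∑' n, ENNReal.ofReal ((x n / μ n) ^ 2) := ENNReal.tsum_mul_left
    _ ≤ _ := mul_le_of_le_one_right' hx2

theorem finiteSeq_mem_ellipsoid {μ : ℕ → ℝ} (hμ : ∀ n, 0 ≤ μ n) {S : Finset ℕ}
    (hS : ∀ n ∈ S, 0 < μ n) {a : ℕ → ℝ} (ha : ∑ n ∈ S, (a n / μ n) ^ 2 ≤ 1) :
    finiteSeq S a ∈ ellipsoid μ := by
  refine ⟨fun n hn => ?_, ?_⟩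
  · rw [finiteSeq_apply, if_neg fun h => (hS n h).ne' hn]
  · rw [tsum_subtype_eq_tsum hμ, tsum_eq_sum (s := S) fun n hn => by
      simp [finiteSeq_apply, hn], ← ENNReal.ofReal_sum_of_nonneg fun _ _ => sq_nonneg _,
      ENNReal.ofReal_le_one]
    refine (Finset.sum_congr rfl fun n hn => ?_).trans_le ha
    rw [finiteSeq_apply, if_pos hn]

theorem measurable_apply_of_isEstimator {f : (ℕ → ℝ) → SqSum} (hf : IsEstimator f) (n : ℕ) :
    Measurable fun y => f y n := by
  borelize SqSum
  exact ((lp.lipschitzWith_one_eval (E := fun _ : ℕ => ℝ) 2 n).continuous.measurable).comp hf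

theorem measurable_norm_of_isEstimator {f : (ℕ → ℝ) → SqSum} (hf : IsEstimator f) :
    Measurable fun y => ‖f y‖ := by
  borelize SqSum
  exact continuous_norm.measurable.comp hf

theorem isEstimator_diagonal (S : Finset ℕ) (c : ℕ → ℝ) :
    IsEstimator fun y => finiteSeq S fun n => c n * y n := by
  borelize SqSum
  have : Continuous fun y : ℕ → ℝ => finiteSeq S fun n => c n * y n := by
    refine continuous_finsetSum S fun n _ => ?_
    exact (lp.isometry_single (E := fun _ : ℕ => ℝ) (p := 2) n).continuous.comp (by fun_prop)
  exact this.measurable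

theorem measurable_observation (σ : ℝ) (x : SqSum) : Measurable (observation σ x) := by
  unfold observation
  fun_prop

theorem mse_eq_tsum {f : (ℕ → ℝ) → SqSum} (hf : IsEstimator f) (σ : ℝ) (x : SqSum) :
    mse σ x f = ∑' n, ∫⁻ ξ, ENNReal.ofReal ((f (observation σ x ξ) n - x n) ^ 2) ∂noise := by
  rw [mse, ← lintegral_tsum]
  · simp_rw [ofReal_norm_sq_eq_tsum]; rfl
  · intro n
    exact ((((measurable_apply_of_isEstimator hf n).comp
      (measurable_observation σ x)).sub_const _).pow_const 2).ennreal_ofReal.aemeasurable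

theorem lintegral_diagonal_sq (σ c x : ℝ) (n : ℕ) :
    ∫⁻ ξ, ENNReal.ofReal ((c * (x + σ * ξ n) - x) ^ 2) ∂noise =
      ENNReal.ofReal (((1 - c) * x) ^ 2 + (c * σ) ^ 2) := by
  have : ∀ ξ : ℕ → ℝ, (c * (x + σ * ξ n) - x) ^ 2 = (-((1 - c) * x) + (c * σ) * ξ n) ^ 2 :=
    fun ξ => by ring
  simp_rw [this]
  rw [lintegral_affine_sq_noise, neg_sq]

theorem minimaxRisk_le_linearMinimaxRisk (σ : ℝ) (K : Set SqSum) :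
    minimaxRisk σ K ≤ linearMinimaxRisk σ K :=
  le_iInf₂ fun f hf => iInf₂_le f hf.1

/-- Upper bound from the diagonal estimator with coefficients `c`: on the ellipsoid the squared bias
is at most `B ^ 2`, and the variance is `∑ (c n * σ) ^ 2`. -/
theorem linearMinimaxRisk_ellipsoid_le {μ : ℕ → ℝ} (hμ : ∀ n, 0 ≤ μ n) (σ : ℝ) (S : Finset ℕ)
    {c : ℕ → ℝ} (hc : ∀ n ∉ S, c n = 0) {B : ℝ} (hB : ∀ n, ((1 - c n) * μ n) ^ 2 ≤ B ^ 2) :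
    linearMinimaxRisk σ (ellipsoid μ) ≤ ENNReal.ofReal (B ^ 2 + ∑ n ∈ S, (c n * σ) ^ 2) := by
  have hest := isEstimator_diagonal S c
  have happ : ∀ (y : ℕ → ℝ) n, finiteSeq S (fun n => c n * y n) n = c n * y n := by
    intro y n
    rw [finiteSeq_apply]
    split_ifs with h
    · rfl
    · simp [hc n h]
  refine (iInf₂_le (fun y => finiteSeq S fun n => c n * y n)
    ⟨hest, c, fun x _ => ae_of_all _ fun ξ n => happ _ n⟩).trans ?_
  refine iSup₂_le fun x hx => ?_
  rw [mse_eq_tsum hest]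
  have hx2 := hx.2
  rw [tsum_subtype_eq_tsum hμ] at hx2
  have hterm : ∀ n, ∫⁻ ξ, ENNReal.ofReal ((finiteSeq S (fun n => c n * observation σ x ξ n) n
      - x n) ^ 2) ∂noise ≤ ENNReal.ofReal (B ^ 2) * ENNReal.ofReal ((x n / μ n) ^ 2) +
        ENNReal.ofReal ((c n * σ) ^ 2) := by
    intro n
    simp_rw [happ]
    simp only [observation]
    rw [lintegral_diagonal_sq, ← ENNReal.ofReal_mul (sq_nonneg _),
      ← ENNReal.ofReal_add (by positivity) (by positivity)]
    apply ENNReal.ofReal_le_ofReal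
    gcongr
    rcases (hμ n).eq_or_lt with h | h
    · simp [hx.1 n h.symm]
    · have : (1 - c n) * x n = ((1 - c n) * μ n) * (x n / μ n) := by field_simp
      rw [this, mul_pow]
      have := hB n
      gcongr
  refine (ENNReal.tsum_le_tsum hterm).trans ?_
  rw [ENNReal.tsum_add, ENNReal.tsum_mul_left, ENNReal.ofReal_add (by positivity)
    (by positivity), ENNReal.ofReal_sum_of_nonneg fun _ _ => sq_nonneg _,
    tsum_eq_sum (s := S) (f := fun n => ENNReal.ofReal ((c n * σ) ^ 2)) fun n hn => by
      simp [hc n hn]]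
  gcongr
  exact mul_le_of_le_one_right' hx2

/-- Lower bound at a fixed parameter `x`: no coefficient of a linear estimator does better in
coordinate `n` than `c = x n ^ 2 / (x n ^ 2 + σ ^ 2)`. -/
theorem ofReal_sum_le_linearMinimaxRisk {K : Set SqSum} {σ : ℝ} (hσ : 0 < σ) {x : SqSum}
    (hx : x ∈ K) (S : Finset ℕ) :
    ENNReal.ofReal (∑ n ∈ S, x n ^ 2 * σ ^ 2 / (x n ^ 2 + σ ^ 2)) ≤ linearMinimaxRisk σ K := by
  refine le_iInf₂ fun f hf => ?_
  obtain ⟨hest, c, hc⟩ := hf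
  refine le_trans ?_ (le_iSup₂ (f := fun x _ => mse σ x f) x hx)
  rw [mse_eq_tsum hest, ENNReal.ofReal_sum_of_nonneg fun _ _ => by positivity]
  refine le_trans (Finset.sum_le_sum fun n _ => ?_) (ENNReal.sum_le_tsum S)
  have : ∫⁻ ξ, ENNReal.ofReal ((f (observation σ x ξ) n - x n) ^ 2) ∂noise =
      ∫⁻ ξ, ENNReal.ofReal ((c n * (x n + σ * ξ n) - x n) ^ 2) ∂noise := by
    refine lintegral_congr_ae ?_
    filter_upwards [hc x hx] with ξ hξ
    rw [hξ n]; rfl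
  rw [this, lintegral_diagonal_sq]
  apply ENNReal.ofReal_le_ofReal
  rw [div_le_iff₀ (by positivity)]
  -- The difference of the two sides is the square of `(1 - c) x² - c σ²`.
  nlinarith [sq_nonneg ((1 - c n) * x n ^ 2 - c n * σ ^ 2)]

/-! ### The critical radius -/

theorem finite_setOf_le {μ : ℕ → ℝ} (hμ : Tendsto μ atTop (𝓝 0)) {ε : ℝ} (hε : 0 < ε) :
    {n | ε ≤ μ n}.Finite := by
  have h := hμ.eventually (gt_mem_nhds hε)
  rw [← Nat.cofinite_eq_atTop] at h
  exact (Filter.mem_cofinite.1 h).subset fun n (hn : ε ≤ μ n) (h' : μ n < ε) => hn.not_gt h'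

theorem typeIntegral_eq_sum {μ : ℕ → ℝ} {ε : ℝ} (hε : 0 < ε) {S : Finset ℕ}
    (hS : ∀ n, n ∈ S ↔ ε < μ n) (τ : ℝ) (hτ : 1 < τ) :
    typeIntegral μ τ ε = ∑ n ∈ S, (ε ^ (1 - τ) - μ n ^ (1 - τ)) / (τ - 1) := by
  have hcount : ∀ u ∈ Ioi ε, countAxes μ u / u ^ τ =
      ∑ n ∈ S, (Ioc ε (μ n)).indicator (fun u => u ^ (-τ)) u := by
    intro u hu
    have hset : {n : ℕ | u ≤ μ n} = (S.filter fun n => u ≤ μ n : Finset ℕ) := by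
      ext n
      simp only [mem_ofPred_eq, Finset.coe_filter, hS]
      exact ⟨fun h => ⟨hu.trans_le h, h⟩, fun h => h.2⟩
    have hu0 : 0 ≤ u := hε.le.trans (le_of_lt hu)
    rw [countAxes, hset, Set.ncard_coe_finset, Finset.card_filter, Nat.cast_sum, Finset.sum_div]
    refine Finset.sum_congr rfl fun n _ => ?_
    simp only [indicator, mem_Ioc, mem_Ioi.1 hu, true_and]
    split_ifs
    · rw [Real.rpow_neg hu0]; simp
    · simp
  have hsub : ∀ n, Ioc ε (μ n) ⊆ Ioi ε := fun n => Ioc_subset_Ioi_self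
  have hii : ∀ n ∈ S, IntervalIntegrable (fun u : ℝ => u ^ (-τ)) volume ε (μ n) := fun n hn =>
    intervalIntegral.intervalIntegrable_rpow (Or.inr (Set.notMem_uIcc_of_lt hε
      (hε.trans ((hS n).1 hn))))
  rw [typeIntegral, setIntegral_congr_fun measurableSet_Ioi hcount, integral_finsetSum]
  · refine Finset.sum_congr rfl fun n hn => ?_
    have hn' := (hS n).1 hn
    rw [setIntegral_indicator measurableSet_Ioc, inter_eq_self_of_subset_right (hsub n),
      ← intervalIntegral.integral_of_le hn'.le, integral_rpow (Or.inr ⟨by linarith,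
        Set.notMem_uIcc_of_lt hε (hε.trans hn')⟩)]
    have : τ - 1 ≠ 0 := by linarith
    have : -τ + 1 ≠ 0 := by linarith
    rw [show -τ + 1 = 1 - τ by ring] at *
    rw [div_eq_div_iff ‹_› ‹_›]
    ring
  · intro n hn
    rw [integrable_indicator_iff measurableSet_Ioc, IntegrableOn,
      Measure.restrict_restrict measurableSet_Ioc, inter_eq_self_of_subset_left (hsub n)]
    exact (hii n hn).1

/-- The contribution `(1/m) (1/ε - 1/m)₊` of a semi-axis `m` to the critical radius equation. -/
noncomputable def axisTerm (m ε : ℝ) : ℝ := max 0 (1 / m * (1 / ε - 1 / m))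

theorem axisTerm_of_lt {m ε : ℝ} (hε : 0 < ε) (h : ε < m) :
    axisTerm m ε = 1 / m * (1 / ε - 1 / m) :=
  max_eq_right (mul_nonneg (one_div_nonneg.2 (hε.trans h).le)
    (sub_nonneg.2 (one_div_le_one_div_of_le hε h.le)))

theorem axisTerm_of_le {m ε : ℝ} (hm : 0 ≤ m) (h : m ≤ ε) : axisTerm m ε = 0 := by
  rcases hm.eq_or_lt with rfl | hm
  · simp [axisTerm]
  · exact max_eq_left (mul_nonpos_of_nonneg_of_nonpos (one_div_nonneg.2 hm.le)
      (sub_nonpos.2 (one_div_le_one_div_of_le hm h)))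

theorem axisTerm_anti {m ε ε' : ℝ} (hm : 0 ≤ m) (hε : 0 < ε) (h : ε ≤ ε') :
    axisTerm m ε' ≤ axisTerm m ε :=
  max_le_max le_rfl (mul_le_mul_of_nonneg_left
    (sub_le_sub_right (one_div_le_one_div_of_le hε h) _) (one_div_nonneg.2 hm))

/-- The left-hand side of the critical radius equation as a finite sum over the semi-axes. The index
set may be any finite set that contains all semi-axes longer than `ε`, so that one set serves a
whole interval of radii. -/
theorem critical_lhs_eq_sum {μ : ℕ → ℝ} (hμ : ∀ n, 0 ≤ μ n) {ε : ℝ} (hε : 0 < ε) {S : Finset ℕ}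
    (hS : ∀ n, ε < μ n → n ∈ S) :
    2 * typeIntegral μ 3 ε - typeIntegral μ 2 ε / ε = ∑ n ∈ S, axisTerm (μ n) ε := by
  classical
  have hT : ∀ n, n ∈ S.filter (fun n => ε < μ n) ↔ ε < μ n := fun n => by
    simpa using hS n
  rw [typeIntegral_eq_sum hε hT 3 (by norm_num), typeIntegral_eq_sum hε hT 2 (by norm_num),
    ← Finset.sum_filter_of_ne (p := fun n => ε < μ n) (s := S), Finset.mul_sum, Finset.sum_div,
    ← Finset.sum_sub_distrib]
  · refine Finset.sum_congr rfl fun n hn => ?_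
    have hn' := (hT n).1 hn
    have hμn := hε.trans hn'
    rw [axisTerm_of_lt hε hn', show (1 - 3 : ℝ) = -(2 : ℕ) by norm_num,
      show (1 - 2 : ℝ) = -(1 : ℕ) by norm_num, Real.rpow_neg hε.le, Real.rpow_neg hμn.le,
      Real.rpow_neg hε.le, Real.rpow_neg hμn.le]
    simp only [Real.rpow_natCast]
    field_simp
    ring
  · intro n _ hn
    by_contra h
    exact hn (axisTerm_of_le (hμ n) (not_lt.1 h))

theorem isCriticalRadius_iff {μ : ℕ → ℝ} (hμ : ∀ n, 0 ≤ μ n) {σ ε : ℝ} (hε : 0 < ε)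
    {S : Finset ℕ} (hS : ∀ n, ε < μ n → n ∈ S) :
    IsCriticalRadius μ σ ε ↔ σ ^ 2 * ∑ n ∈ S, axisTerm (μ n) ε = 1 := by
  rw [IsCriticalRadius, critical_lhs_eq_sum hμ hε hS, and_iff_right hε]

theorem existsUnique_isCriticalRadius {μ : ℕ → ℝ} (hμ : ∀ n, 0 ≤ μ n) (hne : ∃ n, μ n ≠ 0)
    (hlim : Tendsto μ atTop (𝓝 0)) {σ : ℝ} (hσ : 0 < σ) : ∃! ε, IsCriticalRadius μ σ ε := by
  obtain ⟨k, hk⟩ := hne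
  have hk : 0 < μ k := (hμ k).lt_of_ne' hk
  obtain ⟨M, hM⟩ := hlim.bddAbove_range
  have hM : ∀ n, μ n ≤ M := fun n => hM ⟨n, rfl⟩
  -- A radius at which the single term of index `k` already exceeds `1 / σ ^ 2`.
  set a : ℝ := (μ k / σ ^ 2 + 1 / μ k)⁻¹ with ha
  have ha0 : 0 < a := by positivity
  have haM : a ≤ M := by
    refine le_trans ?_ (hM k)
    rw [ha, inv_le_comm₀ (by positivity) hk, ← one_div]
    exact le_add_of_nonneg_left (by positivity)
  set S := (finite_setOf_le hlim ha0).toFinset with hSdef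
  have hS : ∀ ε, a ≤ ε → ∀ n, ε < μ n → n ∈ S := fun ε hε n hn => by
    simpa [hSdef] using hε.trans hn.le
  have hkS : k ∈ S := by
    simp only [hSdef, Finite.mem_toFinset, mem_ofPred_eq]
    rw [ha, inv_le_comm₀ (by positivity) hk, ← one_div]
    exact le_add_of_nonneg_left (by positivity)
  have hcont : ContinuousOn (fun ε => σ ^ 2 * ∑ n ∈ S, axisTerm (μ n) ε) (Icc a M) := by
    refine continuousOn_const.mul (continuousOn_finsetSum _ fun n _ => ?_)
    refine continuousOn_const.sup (continuousOn_const.mul (ContinuousOn.sub ?_ continuousOn_const))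
    exact continuousOn_const.div continuousOn_id fun x hx => (ha0.trans_le hx.1).ne'
  have hleft : 1 ≤ σ ^ 2 * ∑ n ∈ S, axisTerm (μ n) a := by
    have h1 : axisTerm (μ k) a ≤ ∑ n ∈ S, axisTerm (μ n) a :=
      Finset.single_le_sum (f := fun n => axisTerm (μ n) a) (fun n _ => le_max_left _ _) hkS
    have h2 : 1 / σ ^ 2 ≤ axisTerm (μ k) a := by
      refine le_trans (le_of_eq ?_) (le_max_right _ _)
      rw [one_div a, ha, inv_inv]
      field_simp
      ring
    have := mul_le_mul_of_nonneg_left (h2.trans h1) (sq_nonneg σ)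
    rwa [mul_one_div_cancel (by positivity)] at this
  have hright : σ ^ 2 * ∑ n ∈ S, axisTerm (μ n) M = 0 := by
    rw [Finset.sum_eq_zero fun n _ => axisTerm_of_le (hμ n) (hM n), mul_zero]
  obtain ⟨ε, hε, hε1⟩ := intermediate_value_Icc' haM hcont ⟨hright.le.trans zero_le_one, hleft⟩
  have hε0 : 0 < ε := ha0.trans_le hε.1
  refine ⟨ε, (isCriticalRadius_iff hμ hε0 (hS ε hε.1)).2 hε1, ?_⟩
  -- Two solutions cannot be distinct: the sum is strictly decreasing as long as it is positive.
  have huniq : ∀ ε ε', IsCriticalRadius μ σ ε → IsCriticalRadius μ σ ε' → ¬ ε < ε' := by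
    intro ε ε' h h' hlt
    have hε := h.1
    have hε' := h'.1
    set T := (finite_setOf_le hlim hε).toFinset with hTdef
    have hT : ∀ n, ε < μ n → n ∈ T := fun n hn => by simpa [hTdef] using hn.le
    rw [isCriticalRadius_iff hμ hε hT] at h
    rw [isCriticalRadius_iff hμ hε' fun n hn => hT n (hlt.trans hn)] at h'
    have hpos : 0 < ∑ n ∈ T, axisTerm (μ n) ε' := by
      by_contra hneg
      have := mul_nonpos_of_nonneg_of_nonpos (sq_nonneg σ) (not_lt.1 hneg)
      linarith
    obtain ⟨n, hn, hnpos⟩ := Finset.exists_lt_of_sum_lt (by simpa using hpos :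
      ∑ n ∈ T, (0 : ℝ) < ∑ n ∈ T, axisTerm (μ n) ε')
    have hn' : ε' < μ n := by
      by_contra hle
      exact hnpos.ne' (axisTerm_of_le (hμ n) (not_lt.1 hle))
    have hsum : ∑ n ∈ T, axisTerm (μ n) ε' < ∑ n ∈ T, axisTerm (μ n) ε := by
      refine Finset.sum_lt_sum (fun m _ => axisTerm_anti (hμ m) hε hlt.le) ⟨n, hn, ?_⟩
      rw [axisTerm_of_lt hε' hn', axisTerm_of_lt hε (hlt.trans hn')]
      have := one_div_lt_one_div_of_lt hε hlt
      have := one_div_pos.2 (hε'.trans hn')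
      gcongr
    have := mul_lt_mul_of_pos_left hsum (by positivity : 0 < σ ^ 2)
    linarith
  intro ε' h'
  have h := (isCriticalRadius_iff hμ hε0 (hS ε hε.1)).2 hε1
  exact le_antisymm (not_lt.1 (huniq _ _ h h')) (not_lt.1 (huniq _ _ h' h))

theorem isCriticalRadius_criticalRadius {μ : ℕ → ℝ} (hμ : ∀ n, 0 ≤ μ n) (hne : ∃ n, μ n ≠ 0)
    (hlim : Tendsto μ atTop (𝓝 0)) {σ : ℝ} (hσ : 0 < σ) :
    IsCriticalRadius μ σ (criticalRadius μ σ) :=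
  Classical.epsilon_spec (existsUnique_isCriticalRadius hμ hne hlim hσ).exists

/-! ### Comparison of the minimax risk with a Gaussian prior -/

theorem norm_radial_truncation_le {E : Type*} [NormedAddCommGroup E] [NormedSpace ℝ E] {M : ℝ}
    (hM : 0 < M) (v : E) : ‖(M / max M ‖v‖) • v‖ ≤ M := by
  have h0 : 0 < max M ‖v‖ := lt_max_of_lt_left hM
  rw [norm_smul, Real.norm_of_nonneg (by positivity), div_mul_eq_mul_div, div_le_iff₀ h0]
  exact mul_le_mul_of_nonneg_left (le_max_right _ _) hM.le

/-- Radial truncation to the ball of radius `M` does not increase the distance to a point of it. -/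
theorem norm_radial_truncation_sub_le {E : Type*} [NormedAddCommGroup E] [InnerProductSpace ℝ E]
    {M : ℝ} (hM : 0 < M) (v : E) {x : E} (hx : ‖x‖ ≤ M) :
    ‖(M / max M ‖v‖) • v - x‖ ≤ ‖v - x‖ := by
  rcases le_total ‖v‖ M with h | h
  · rw [max_eq_left h, div_self hM.ne', one_smul]
  · have hv : 0 < ‖v‖ := hM.trans_le h
    rw [max_eq_right h]
    set c := M / ‖v‖ with hc
    have hc0 : 0 ≤ c := by positivity
    have hc1 : c ≤ 1 := (div_le_one hv).2 h
    have hcv : c * ‖v‖ = M := div_mul_cancel₀ _ hv.ne'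
    rw [← sq_le_sq₀ (norm_nonneg _) (norm_nonneg _), norm_sub_sq_real, norm_sub_sq_real,
      norm_smul, Real.norm_of_nonneg hc0, real_inner_smul_left]
    have hin : inner ℝ v x ≤ c * ‖v‖ ^ 2 := by
      calc inner ℝ v x ≤ ‖v‖ * ‖x‖ := real_inner_le_norm v x
        _ ≤ ‖v‖ * M := by gcongr
        _ = c * ‖v‖ ^ 2 := by rw [← hcv]; ring
    have h1 := mul_le_mul_of_nonneg_left hin (sub_nonneg.2 hc1)
    nlinarith [mul_nonneg (sq_nonneg (1 - c)) (sq_nonneg ‖v‖)]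

theorem norm_sq_finiteSeq (S : Finset ℕ) (a : ℕ → ℝ) : ‖finiteSeq S a‖ ^ 2 = ∑ n ∈ S, a n ^ 2 := by
  have h := lp.norm_sum_single (E := fun _ : ℕ => ℝ) (p := 2) (by norm_num) a S
  simpa [finiteSeq] using h

/-- The Bayes risk of a Gaussian prior with finite support `S` is at most the minimax risk plus a
correction for the draws outside the ellipsoid. There `Q = ∑ (x n / μ n) ^ 2 > 1`, the squared
error of an estimator truncated to the ball of radius `M` is at most `2 M ^ 2 (1 + Q)`, and
`(1 + Q) / 2 ≤ exp (l (Q - 1))` as soon as `l ≥ 1/2`. -/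
theorem bayes_le_minimaxRisk {μ : ℕ → ℝ} (hμ : ∀ n, 0 ≤ μ n) {M : ℝ} (hM0 : 0 < M)
    (hM : ∀ n, μ n ≤ M) {σ : ℝ} (hσ : 0 < σ) {S : Finset ℕ} (hS : ∀ n ∈ S, 0 < μ n)
    {τ : ℕ → ℝ} (hτ : ∀ n ∉ S, τ n = 0) {l : ℝ} (hl : 1 / 2 ≤ l) :
    ENNReal.ofReal (∑ n ∈ S, τ n ^ 2 * σ ^ 2 / (τ n ^ 2 + σ ^ 2)) ≤
      minimaxRisk σ (ellipsoid μ) + ∫⁻ g, ENNReal.ofReal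
        (4 * M ^ 2 * Real.exp (l * (∑ n ∈ S, (τ n * g n / μ n) ^ 2 - 1))) ∂noise := by
  rw [minimaxRisk, ENNReal.iInf_add]
  refine le_iInf fun f => ?_
  rw [ENNReal.iInf_add]
  refine le_iInf fun hf => ?_
  set φ : (ℕ → ℝ) → SqSum := fun y => (M / max M ‖f y‖) • f y with hφdef
  have hφ : ∀ n, Measurable fun y => φ y n := by
    intro n
    have h1 := measurable_apply_of_isEstimator hf n
    have h2 := measurable_norm_of_isEstimator hf
    have : (fun y => φ y n) = fun y => (M / max M ‖f y‖) * f y n := by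
      ext y; simp [hφdef]
    rw [this]
    exact (measurable_const.div (measurable_const.max h2)).mul h1
  have hobs : ∀ g ξ : ℕ → ℝ, observation σ (finiteSeq S fun n => τ n * g n) ξ =
      fun k => τ k * g k + σ * ξ k := by
    intro g ξ
    ext k
    rw [observation, finiteSeq_apply]
    split_ifs with h
    · rfl
    · rw [hτ k h, zero_mul]
  have hpoint : ∀ g : ℕ → ℝ, ∫⁻ ξ, ∑ n ∈ S, ENNReal.ofReal
      ((φ (fun k => τ k * g k + σ * ξ k) n - τ n * g n) ^ 2) ∂noise ≤
      (⨆ x ∈ ellipsoid μ, mse σ x f) + ENNReal.ofReal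
        (4 * M ^ 2 * Real.exp (l * (∑ n ∈ S, (τ n * g n / μ n) ^ 2 - 1))) := by
    intro g
    set x := finiteSeq S fun n => τ n * g n with hx
    set Q := ∑ n ∈ S, (τ n * g n / μ n) ^ 2 with hQ
    have hcoord : ∀ ξ : ℕ → ℝ, ∑ n ∈ S, ENNReal.ofReal
        ((φ (fun k => τ k * g k + σ * ξ k) n - τ n * g n) ^ 2) ≤
        ENNReal.ofReal (‖φ (observation σ x ξ) - x‖ ^ 2) := by
      intro ξ
      refine le_trans (le_of_eq ?_) (sum_ofReal_sq_le_ofReal_norm_sq S _)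
      refine Finset.sum_congr rfl fun n hn => ?_
      rw [hobs, lp.coeFn_sub, Pi.sub_apply, hx, finiteSeq_apply, if_pos hn]
    refine (lintegral_mono hcoord).trans ?_
    rcases le_or_gt Q 1 with h | h
    · -- The prior draw lies in the ellipsoid: the truncation does not increase the error.
      have hmem : x ∈ ellipsoid μ := finiteSeq_mem_ellipsoid hμ hS h
      have hxM : ‖x‖ ≤ M := by
        have := norm_sq_le_of_mem_ellipsoid hμ hM hmem
        exact (sq_le_sq₀ (norm_nonneg _) hM0.le).1 this
      refine le_trans ?_ (le_trans (le_iSup₂ (f := fun x _ => mse σ x f) x hmem) le_self_add)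
      refine lintegral_mono fun ξ => ENNReal.ofReal_le_ofReal ?_
      gcongr
      exact norm_radial_truncation_sub_le hM0 _ hxM
    · -- Outside the ellipsoid both `φ` and the draw are controlled by `Q`.
      refine le_trans ?_ le_add_self
      have hxQ : ‖x‖ ^ 2 ≤ M ^ 2 * Q := by
        rw [hx, norm_sq_finiteSeq, hQ, Finset.mul_sum]
        refine Finset.sum_le_sum fun n hn => ?_
        have h0 := hS n hn
        have : τ n * g n = μ n * (τ n * g n / μ n) := by field_simp
        conv_lhs => rw [this, mul_pow]
        have := hM n
        gcongr
      have hexp : (1 + Q) / 2 ≤ Real.exp (l * (Q - 1)) := by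
        have h1 := Real.add_one_le_exp (l * (Q - 1))
        have h2 : 1 / 2 * (Q - 1) ≤ l * (Q - 1) := by gcongr
        linarith
      have hbound : ∀ ξ, ‖φ (observation σ x ξ) - x‖ ^ 2 ≤
          4 * M ^ 2 * Real.exp (l * (Q - 1)) := by
        intro ξ
        have h1 : ‖φ (observation σ x ξ)‖ ≤ M := norm_radial_truncation_le hM0 _
        have h2 := norm_sub_le (φ (observation σ x ξ)) x
        have h3 : ‖φ (observation σ x ξ) - x‖ ^ 2 ≤ (M + ‖x‖) ^ 2 := by
          have := norm_nonneg (φ (observation σ x ξ) - x)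
          gcongr
          linarith
        have h4 : M ^ 2 * ((1 + Q) / 2) ≤ M ^ 2 * Real.exp (l * (Q - 1)) := by gcongr
        nlinarith [sq_nonneg (M - ‖x‖)]
      calc _ ≤ ∫⁻ _ : ℕ → ℝ, ENNReal.ofReal (4 * M ^ 2 * Real.exp (l * (Q - 1))) ∂noise :=
            lintegral_mono fun ξ => ENNReal.ofReal_le_ofReal (hbound ξ)
        _ = _ := by simp
  have hmeas : ∀ n, Measurable fun p : (ℕ → ℝ) × (ℕ → ℝ) =>
      ENNReal.ofReal ((φ (fun k => τ k * p.1 k + σ * p.2 k) n - τ n * p.1 n) ^ 2) := by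
    intro n
    have h1 : Measurable fun p : (ℕ → ℝ) × (ℕ → ℝ) => fun k => τ k * p.1 k + σ * p.2 k := by
      fun_prop
    have h2 : Measurable fun p : (ℕ → ℝ) × (ℕ → ℝ) => τ n * p.1 n := by fun_prop
    exact ((((hφ n).comp h1).sub h2).pow_const 2).ennreal_ofReal
  calc ENNReal.ofReal (∑ n ∈ S, τ n ^ 2 * σ ^ 2 / (τ n ^ 2 + σ ^ 2))
      = ∑ n ∈ S, ENNReal.ofReal (τ n ^ 2 * σ ^ 2 / (τ n ^ 2 + σ ^ 2)) :=
        ENNReal.ofReal_sum_of_nonneg fun _ _ => by positivity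
    _ ≤ ∑ n ∈ S, ∫⁻ g, ∫⁻ ξ, ENNReal.ofReal
        ((φ (fun k => τ k * g k + σ * ξ k) n - τ n * g n) ^ 2) ∂noise ∂noise :=
        Finset.sum_le_sum fun n _ => bayes_coordinate_lower_bound hσ τ n (hφ n)
    _ = ∫⁻ g, ∫⁻ ξ, ∑ n ∈ S, ENNReal.ofReal
        ((φ (fun k => τ k * g k + σ * ξ k) n - τ n * g n) ^ 2) ∂noise ∂noise := by
        rw [← lintegral_finsetSum _ fun n _ => (hmeas n).lintegral_prod_right']
        refine lintegral_congr fun g => ?_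
        exact (lintegral_finsetSum S fun n _ => (hmeas n).comp (measurable_prodMk_left (x := g))).symm
    _ ≤ _ := by
        refine (lintegral_mono hpoint).trans ?_
        rw [lintegral_add_left measurable_const]
        simp

/-- Chernoff bound for the prior shrunk by the factor `s`: here `w n` is the share of coordinate `n`
in `∑ (x n / μ n) ^ 2`, and `l = (1 - s) * r ^ 2` minimizes the exponent
`-l (1 - s) + l ^ 2 / (2 r ^ 2)`. -/
theorem lintegral_exp_prior_le {S : Finset ℕ} {w : ℕ → ℝ} {s l r : ℝ}
    (hw0 : ∀ n ∈ S, 0 ≤ w n) (hw1 : ∑ n ∈ S, w n = 1) (hr : 0 < r)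
    (hw : ∀ n ∈ S, w n ≤ 1 / (4 * r ^ 2)) (hs0 : 0 ≤ s) (hs1 : s ≤ 1)
    (hl : l = (1 - s) * r ^ 2) :
    ∫⁻ g, ENNReal.ofReal (Real.exp (l * (∑ n ∈ S, s * w n * g n ^ 2 - 1))) ∂noise ≤
      ENNReal.ofReal (Real.exp (-((1 - s) ^ 2 * r ^ 2 / 2))) := by
  have hl0 : 0 ≤ l := hl ▸ mul_nonneg (sub_nonneg.2 hs1) (sq_nonneg r)
  set θ : ℕ → ℝ := fun n => l * s * w n with hθ
  have h0 : ∀ n ∈ S, 0 ≤ θ n := fun n hn => mul_nonneg (mul_nonneg hl0 hs0) (hw0 n hn)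
  have hle : ∀ n ∈ S, θ n ≤ (1 - s) / 4 := by
    intro n hn
    calc θ n ≤ l * 1 * (1 / (4 * r ^ 2)) := by
          have := hw n hn
          have := hw0 n hn
          simp only [hθ]
          gcongr
      _ = (1 - s) / 4 := by rw [hl]; field_simp
  have h1 : ∀ n ∈ S, θ n ≤ 1 / 4 := fun n hn => (hle n hn).trans (by linarith)
  have hsum : ∑ n ∈ S, θ n = l * s := by rw [hθ, ← Finset.mul_sum, hw1, mul_one]
  have hsum2 : ∑ n ∈ S, 2 * θ n ^ 2 ≤ l * (1 - s) / 2 := by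
    calc ∑ n ∈ S, 2 * θ n ^ 2 ≤ ∑ n ∈ S, (1 - s) / 2 * θ n := by
          refine Finset.sum_le_sum fun n hn => ?_
          nlinarith [mul_le_mul_of_nonneg_right (hle n hn) (h0 n hn)]
      _ = (1 - s) / 2 * (l * s) := by rw [← Finset.mul_sum, hsum]
      _ ≤ l * (1 - s) / 2 := by
          nlinarith [mul_le_mul_of_nonneg_left hs1 (mul_nonneg hl0 (sub_nonneg.2 hs1))]
  have hsplit : ∀ g : ℕ → ℝ, ENNReal.ofReal (Real.exp (l * (∑ n ∈ S, s * w n * g n ^ 2 - 1))) =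
      ENNReal.ofReal (Real.exp (-l)) * ENNReal.ofReal (Real.exp (∑ n ∈ S, θ n * g n ^ 2)) := by
    intro g
    rw [← ENNReal.ofReal_mul (Real.exp_pos _).le, ← Real.exp_add]
    congr 2
    rw [mul_sub, Finset.mul_sum, mul_one, sub_eq_neg_add]
    congr 1
    exact Finset.sum_congr rfl fun n _ => by simp only [hθ]; ring
  simp_rw [hsplit]
  rw [lintegral_const_mul _ (by fun_prop)]
  refine (mul_le_mul_right (lintegral_exp_quadratic_noise_le S θ h0 h1) _).trans ?_
  rw [← ENNReal.ofReal_mul (Real.exp_pos _).le, ← Real.exp_add]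
  refine ENNReal.ofReal_le_ofReal (Real.exp_le_exp.2 ?_)
  rw [Finset.sum_add_distrib, hsum]
  calc -l + (l * s + ∑ n ∈ S, 2 * θ n ^ 2) ≤ -l + (l * s + l * (1 - s) / 2) := by gcongr
    _ = _ := by rw [hl]; ring

/-! ### The Lambert W function and the optimal shrinkage of the prior -/

theorem lambertW_spec {x : ℝ} (hx : 0 ≤ x) :
    0 ≤ lambertW x ∧ lambertW x * Real.exp (lambertW x) = x := by
  have hcont : ContinuousOn (fun w : ℝ => w * Real.exp w) (Icc 0 x) := by fun_prop
  have hex : ∃ w ∈ Ici (-1 : ℝ), w * Real.exp w = x := by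
    obtain ⟨w, hw, hwx⟩ := intermediate_value_Icc hx hcont
      (show x ∈ Icc _ _ by
        simp only [zero_mul, mem_Icc, hx, true_and]
        exact le_mul_of_one_le_right hx (Real.one_le_exp hx))
    exact ⟨w, mem_Ici.2 (by linarith [hw.1]), hwx⟩
  have heq : lambertW x * Real.exp (lambertW x) = x := Function.invFunOn_eq hex
  refine ⟨?_, heq⟩
  by_contra h
  have := mul_neg_of_neg_of_pos (not_le.1 h) (Real.exp_pos (lambertW x))
  linarith

theorem lambertW_le_log {x : ℝ} (hx : Real.exp 1 ≤ x) : lambertW x ≤ Real.log x := by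
  have hx0 : 0 < x := (Real.exp_pos 1).trans_le hx
  obtain ⟨h0, h⟩ := lambertW_spec hx0.le
  rcases le_total (lambertW x) 1 with h1 | h1
  · exact h1.trans ((Real.le_log_iff_exp_le hx0).2 hx)
  · rw [Real.le_log_iff_exp_le hx0]
    calc Real.exp (lambertW x) ≤ lambertW x * Real.exp (lambertW x) :=
          le_mul_of_one_le_left (Real.exp_pos _).le h1
      _ = x := h

/-- Optimization over the shrinkage `η`. With `η = 2 √2 √W / r` the equation for `W` makes the
probability term at most `η L`, so the relative loss is at most `2 η`. If `2 η ≥ 1` there is nothing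
to prove, and otherwise `L ≤ M ^ 2` forces `W ≥ 1` and makes the hypothesis on `η` available. -/
theorem abs_ratio_sub_one_le {R L M r W : ℝ} (hR0 : 0 ≤ R) (hRL : R ≤ L) (hL : 0 < L)
    (hLM : L ≤ M ^ 2) (hr : 0 < r) (hW0 : 0 ≤ W)
    (hW : W * Real.exp W = ((1 + √3) * M ^ 2 * r / (√2 * L)) ^ 2)
    (hbayes : ∀ η, 0 ≤ η → η ≤ 1 → 1 / 2 ≤ η * r ^ 2 →
      (1 - η) * L ≤ R + 4 * M ^ 2 * Real.exp (-(η ^ 2 * r ^ 2 / 2))) :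
    |R / L - 1| ≤ 4 * √2 / r * √W := by
  have h2 : √2 ^ 2 = 2 := Real.sq_sqrt (by norm_num)
  have h2pos : 0 < √2 := by positivity
  have h3 : 1 ≤ √3 := by rw [Real.one_le_sqrt]; norm_num
  have hWsq : √W ^ 2 = W := Real.sq_sqrt hW0
  have hWn := Real.sqrt_nonneg W
  set η := 2 * √2 / r * √W with hη
  have hη0 : 0 ≤ η := by positivity
  have hgoal : 4 * √2 / r * √W = 2 * η := by rw [hη]; ring
  have hRL1 : R / L ≤ 1 := (div_le_one hL).2 hRL
  have hRL0 : 0 ≤ R / L := div_nonneg hR0 hL.le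
  rw [hgoal, abs_sub_comm, abs_of_nonneg (by linarith)]
  rcases le_or_gt 1 (2 * η) with hbig | hsmall
  · linarith
  have hηr : η * r = 2 * √2 * √W := by rw [hη]; field_simp
  have hηsq : η ^ 2 * r ^ 2 = 8 * W := by
    rw [← mul_pow, hηr, mul_pow, mul_pow, h2, hWsq]; ring
  have hz : 2 * r ^ 2 ≤ W * Real.exp W := by
    rw [hW]
    have h1 : √2 * r ≤ (1 + √3) * M ^ 2 * r / (√2 * L) := by
      rw [le_div_iff₀ (by positivity)]
      calc √2 * r * (√2 * L) = √2 ^ 2 * L * r := by ring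
        _ = 2 * L * r := by rw [h2]
        _ ≤ (1 + √3) * M ^ 2 * r := by
          gcongr
          linarith
    calc 2 * r ^ 2 = (√2 * r) ^ 2 := by rw [mul_pow, h2]
      _ ≤ _ := by gcongr
  have hr2 : 32 * W < r ^ 2 := by
    have : (2 * η) ^ 2 < 1 := by nlinarith
    nlinarith [sq_nonneg r, pow_pos hr 2]
  have hW1 : 1 ≤ W := by
    by_contra hlt
    have he : Real.exp W ≤ 3 := (Real.exp_le_exp.2 (not_le.1 hlt).le).trans
      Real.exp_one_lt_three.le
    nlinarith [mul_le_mul_of_nonneg_left he hW0]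
  have hsW : 1 ≤ √W := Real.one_le_sqrt.2 hW1
  have hr1 : 1 ≤ r := (one_le_sq_iff₀ hr.le).1 (by linarith)
  have h21 : 1 ≤ √2 := by rw [Real.one_le_sqrt]; norm_num
  have hlam : 1 / 2 ≤ η * r ^ 2 := by
    have : 1 ≤ η * r := by rw [hηr]; nlinarith
    nlinarith
  have hb := hbayes η hη0 (by linarith) hlam
  rw [hηsq] at hb
  -- The error term is at most `η L` by the equation for `W`.
  have hroot : √W * Real.exp (W / 2) = (1 + √3) * M ^ 2 * r / (√2 * L) := by
    rw [← sq_eq_sq₀ (by positivity) (by positivity), ← hW, mul_pow, hWsq, ← Real.exp_nat_mul]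
    congr 2; push_cast; ring
  have herr : 4 * M ^ 2 * Real.exp (-(8 * W / 2)) ≤ η * L := by
    have hM2 : (1 + √3) * M ^ 2 = √W * Real.exp (W / 2) * (√2 * L) / r := by
      rw [hroot]; field_simp
    have hexp : Real.exp (W / 2) * Real.exp (-(8 * W / 2)) ≤ 1 := by
      rw [← Real.exp_add, Real.exp_le_one_iff]; linarith
    calc 4 * M ^ 2 * Real.exp (-(8 * W / 2))
        ≤ 2 * ((1 + √3) * M ^ 2) * Real.exp (-(8 * W / 2)) := by
          refine mul_le_mul_of_nonneg_right ?_ (Real.exp_pos _).le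
          nlinarith [sq_nonneg M]
      _ = η * L * (Real.exp (W / 2) * Real.exp (-(8 * W / 2))) := by rw [hM2, hη]; ring
      _ ≤ η * L := mul_le_of_le_one_right (by positivity) hexp
  have : (1 - 2 * η) * L ≤ R := by linarith
  have := (le_div_iff₀ hL).2 this
  linarith

/-! ### The linear minimax risk -/

theorem finite_setOf_lt {μ : ℕ → ℝ} (hμ : Tendsto μ atTop (𝓝 0)) {ε : ℝ} (hε : 0 < ε) :
    {n | ε < μ n}.Finite := by
  refine (finite_setOf_le hμ hε).subset fun n hn => ?_
  simp only [mem_ofPred_eq] at *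
  exact hn.le

theorem IsCriticalRadius.sum_eq_one {μ : ℕ → ℝ} (hμ : ∀ n, 0 ≤ μ n) {σ ε : ℝ} {S : Finset ℕ}
    (hS : ∀ n, n ∈ S ↔ ε < μ n) (hε : IsCriticalRadius μ σ ε) :
    ∑ n ∈ S, σ ^ 2 * (1 / μ n * (1 / ε - 1 / μ n)) = 1 := by
  refine Eq.trans ?_ ((isCriticalRadius_iff hμ hε.1 fun n hn => (hS n).2 hn).1 hε)
  rw [Finset.mul_sum]
  exact Finset.sum_congr rfl fun n hn => by rw [axisTerm_of_lt hε.1 ((hS n).1 hn)]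

/-- The least favourable parameter of the linear problem, with squared coordinates
`σ² (μ n / ε - 1)₊`; the positive part comes from the convention that `√` vanishes on negative
numbers. -/
noncomputable def leastFavourable (μ : ℕ → ℝ) (σ ε : ℝ) (n : ℕ) : ℝ := σ * √(μ n / ε - 1)

theorem leastFavourable_sq {μ : ℕ → ℝ} {σ ε : ℝ} (hε : 0 < ε) {n : ℕ} (hn : ε < μ n) :
    leastFavourable μ σ ε n ^ 2 = σ ^ 2 * (μ n / ε - 1) := by
  rw [leastFavourable, mul_pow, Real.sq_sqrt]
  rw [sub_nonneg, one_le_div hε]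
  exact hn.le

theorem leastFavourable_div_sq {μ : ℕ → ℝ} {σ ε : ℝ} (hε : 0 < ε) {n : ℕ} (hn : ε < μ n) :
    (leastFavourable μ σ ε n / μ n) ^ 2 = σ ^ 2 * (1 / μ n * (1 / ε - 1 / μ n)) := by
  have := hε.trans hn
  rw [div_pow, leastFavourable_sq hε hn]
  field_simp

theorem leastFavourable_coordinate_risk {μ : ℕ → ℝ} {σ ε : ℝ} (hσ : 0 < σ) (hε : 0 < ε) {n : ℕ}
    (hn : ε < μ n) : leastFavourable μ σ ε n ^ 2 * σ ^ 2 / (leastFavourable μ σ ε n ^ 2 + σ ^ 2) =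
      σ ^ 2 * (1 - ε / μ n) := by
  have := hε.trans hn
  rw [leastFavourable_sq hε hn]
  have h : σ ^ 2 * (μ n / ε - 1) + σ ^ 2 = σ ^ 2 * μ n / ε := by ring
  rw [h]
  field_simp

/-- Pinsker's formula: the coefficients `(1 - ε / μ n)₊` and the parameter `leastFavourable` form a
saddle point of the linear problem. -/
theorem linearMinimaxRisk_ellipsoid_eq {μ : ℕ → ℝ} (hμ : ∀ n, 0 ≤ μ n) {σ ε : ℝ} (hσ : 0 < σ)
    {S : Finset ℕ} (hS : ∀ n, n ∈ S ↔ ε < μ n) (hε : IsCriticalRadius μ σ ε) :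
    linearMinimaxRisk σ (ellipsoid μ) = ENNReal.ofReal (∑ n ∈ S, σ ^ 2 * (1 - ε / μ n)) := by
  have hε0 := hε.1
  have hpos : ∀ n ∈ S, 0 < μ n := fun n hn => hε0.trans ((hS n).1 hn)
  have hsum := hε.sum_eq_one hμ hS
  apply le_antisymm
  · have h := linearMinimaxRisk_ellipsoid_le hμ σ S
      (c := fun n => if n ∈ S then 1 - ε / μ n else 0) (fun n hn => if_neg hn) (B := ε) (by
        intro n
        split_ifs with hn
        · have := hpos n hn
          rw [show (1 - (1 - ε / μ n)) * μ n = ε by field_simp; ring]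
        · have h1 : μ n ≤ ε := not_lt.1 fun h => hn ((hS n).2 h)
          have h2 := hμ n
          rw [sub_zero, one_mul]
          gcongr)
    refine h.trans_eq (congrArg _ ?_)
    -- The bias `ε ^ 2` is rewritten by the critical radius equation.
    calc ε ^ 2 + ∑ n ∈ S, ((if n ∈ S then 1 - ε / μ n else 0) * σ) ^ 2
        = ∑ n ∈ S, (ε ^ 2 * (σ ^ 2 * (1 / μ n * (1 / ε - 1 / μ n))) +
            ((1 - ε / μ n) * σ) ^ 2) := by
          rw [Finset.sum_add_distrib, ← Finset.mul_sum, hsum, mul_one]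
          congr 1
          exact Finset.sum_congr rfl fun n hn => by rw [if_pos hn]
      _ = _ := Finset.sum_congr rfl fun n hn => by
          have := hpos n hn
          field_simp
          ring
  · have hmem : finiteSeq S (leastFavourable μ σ ε) ∈ ellipsoid μ :=
      finiteSeq_mem_ellipsoid hμ hpos (by
        rw [← hsum]
        exact (Finset.sum_congr rfl fun n hn =>
          leastFavourable_div_sq hε0 ((hS n).1 hn)).le)
    refine le_trans (le_of_eq ?_) (ofReal_sum_le_linearMinimaxRisk hσ hmem S)
    refine congrArg _ (Finset.sum_congr rfl fun n hn => ?_)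
    rw [finiteSeq_apply, if_pos hn, leastFavourable_coordinate_risk hσ hε0 ((hS n).1 hn)]

theorem sum_linear_risk_pos {μ : ℕ → ℝ} (hμ : ∀ n, 0 ≤ μ n) {σ ε : ℝ} (hσ : 0 < σ)
    {S : Finset ℕ} (hS : ∀ n, n ∈ S ↔ ε < μ n) (hε : IsCriticalRadius μ σ ε) :
    0 < ∑ n ∈ S, σ ^ 2 * (1 - ε / μ n) := by
  have hne : S.Nonempty := by
    by_contra h
    have := hε.sum_eq_one hμ hS
    simp [Finset.not_nonempty_iff_eq_empty.1 h] at this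
  refine Finset.sum_pos (fun n hn => ?_) hne
  have h := (hS n).1 hn
  have := (div_lt_one (hε.1.trans h)).2 h
  exact mul_pos (by positivity) (by linarith)

/-- Each term of the linear risk is `μ n * ε` times a term of the critical radius equation. -/
theorem sum_linear_risk_le {μ : ℕ → ℝ} (hμ : ∀ n, 0 ≤ μ n) {σ ε : ℝ}
    {S : Finset ℕ} (hS : ∀ n, n ∈ S ↔ ε < μ n) (hε : IsCriticalRadius μ σ ε) {M : ℝ}
    (hM : ∀ n, μ n ≤ M) :
    ∑ n ∈ S, σ ^ 2 * (1 - ε / μ n) ≤ M * ε := by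
  have hε0 := hε.1
  rw [← mul_one (M * ε), show M * ε * 1 = M * ε * _ from congrArg _ (hε.sum_eq_one hμ hS).symm,
    Finset.mul_sum]
  refine Finset.sum_le_sum fun n hn => ?_
  have h := (hS n).1 hn
  have h0 := hε0.trans h
  have h1 : 1 / μ n ≤ 1 / ε := one_div_le_one_div_of_le hε0 h.le
  calc σ ^ 2 * (1 - ε / μ n) = μ n * ε * (σ ^ 2 * (1 / μ n * (1 / ε - 1 / μ n))) := by field_simp
    _ ≤ M * ε * (σ ^ 2 * (1 / μ n * (1 / ε - 1 / μ n))) := by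
      have := mul_nonneg (one_div_pos.2 h0).le (sub_nonneg.2 h1)
      have := hM n
      gcongr

/-! ### The minimax risk against the linear minimax risk -/

/-- Lower bound for the minimax risk from the Gaussian prior with variances
`(1 - η) * leastFavourable μ σ ε n ^ 2`. -/
theorem shrunk_linear_risk_le_minimaxRisk {μ : ℕ → ℝ} (hμ : ∀ n, 0 ≤ μ n) {σ ε : ℝ} (hσ : 0 < σ)
    {S : Finset ℕ} (hS : ∀ n, n ∈ S ↔ ε < μ n) (hε : IsCriticalRadius μ σ ε) {M : ℝ}
    (hM0 : 0 < M) (hM : ∀ n, μ n ≤ M) {η : ℝ} (hη0 : 0 ≤ η) (hη1 : η ≤ 1)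
    (hη : 1 / 2 ≤ η * (ε / σ) ^ 2) :
    ENNReal.ofReal ((1 - η) * ∑ n ∈ S, σ ^ 2 * (1 - ε / μ n)) ≤ minimaxRisk σ (ellipsoid μ) +
      ENNReal.ofReal (4 * M ^ 2 * Real.exp (-(η ^ 2 * (ε / σ) ^ 2 / 2))) := by
  have hε0 := hε.1
  have hpos : ∀ n ∈ S, 0 < μ n := fun n hn => hε0.trans ((hS n).1 hn)
  have hs0 : 0 ≤ 1 - η := by linarith
  set b := leastFavourable μ σ ε with hb
  set τ : ℕ → ℝ := fun n => if n ∈ S then √(1 - η) * b n else 0 with hτ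
  have hτS : ∀ n ∈ S, τ n = √(1 - η) * b n := fun n hn => if_pos hn
  have hτsq : ∀ n ∈ S, τ n ^ 2 = (1 - η) * b n ^ 2 := fun n hn => by
    rw [hτS n hn, mul_pow, Real.sq_sqrt hs0]
  have hbayes := bayes_le_minimaxRisk hμ hM0 hM hσ hpos (τ := τ) (fun n hn => if_neg hn) hη
  refine le_trans (ENNReal.ofReal_le_ofReal ?_) (hbayes.trans (add_le_add_right ?_ _))
  · rw [Finset.mul_sum]
    refine Finset.sum_le_sum fun n hn => ?_
    rw [← leastFavourable_coordinate_risk hσ hε0 ((hS n).1 hn), hτsq n hn, ← hb,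
      ← mul_div_assoc, mul_assoc (1 - η)]
    gcongr
    exact mul_le_of_le_one_left (sq_nonneg _) (by linarith)
  · set w : ℕ → ℝ := fun n => (b n / μ n) ^ 2 with hw
    have hwS : ∀ n ∈ S, w n = σ ^ 2 * (1 / μ n * (1 / ε - 1 / μ n)) := fun n hn =>
      leastFavourable_div_sq hε0 ((hS n).1 hn)
    have hexp := lintegral_exp_prior_le (S := S) (w := w) (s := 1 - η) (r := ε / σ)
      (fun n _ => sq_nonneg _) ((Finset.sum_congr rfl hwS).trans (hε.sum_eq_one hμ hS))
      (by positivity) (fun n hn => by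
        -- The parabola `t (1/ε - t)` has maximum `1 / (4 ε²)`.
        have h1 : 1 / (4 * (ε / σ) ^ 2) = σ ^ 2 * (1 / ε / 2) ^ 2 := by field_simp; norm_num
        rw [hwS n hn, h1]
        gcongr
        nlinarith [sq_nonneg (1 / ε / 2 - 1 / μ n)]) hs0 (by linarith) rfl
    rw [sub_sub_cancel] at hexp
    have hint : ∀ g : ℕ → ℝ, ENNReal.ofReal (4 * M ^ 2 *
        Real.exp (η * (ε / σ) ^ 2 * (∑ n ∈ S, (τ n * g n / μ n) ^ 2 - 1))) =
        ENNReal.ofReal (4 * M ^ 2) * ENNReal.ofReal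
          (Real.exp (η * (ε / σ) ^ 2 * (∑ n ∈ S, (1 - η) * w n * g n ^ 2 - 1))) := by
      intro g
      rw [← ENNReal.ofReal_mul (by positivity)]
      congr 5
      refine Finset.sum_congr rfl fun n hn => ?_
      rw [mul_div_right_comm, mul_pow, div_pow, hτsq n hn, hw]
      ring
    simp_rw [hint]
    rw [lintegral_const_mul _ (by fun_prop), ENNReal.ofReal_mul (p := 4 * M ^ 2) (by positivity)]
    exact mul_le_mul_right hexp _

theorem le_maxAxis {μ : ℕ → ℝ} (hlim : Tendsto μ atTop (𝓝 0)) (n : ℕ) : μ n ≤ maxAxis μ :=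
  le_ciSup hlim.bddAbove_range n

theorem linearRisk_pos_and_le {μ : ℕ → ℝ} (hμ : ∀ n, 0 ≤ μ n) (hne : ∃ n, μ n ≠ 0)
    (hlim : Tendsto μ atTop (𝓝 0)) {σ : ℝ} (hσ : 0 < σ) :
    0 < linearRisk μ σ ∧ linearRisk μ σ ≤ maxAxis μ * criticalRadius μ σ := by
  have hε := isCriticalRadius_criticalRadius hμ hne hlim hσ
  have hfin : {n | criticalRadius μ σ < μ n}.Finite := finite_setOf_lt hlim hε.1
  have hS : ∀ n, n ∈ hfin.toFinset ↔ criticalRadius μ σ < μ n := fun n => by simp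
  have hpos := sum_linear_risk_pos hμ hσ hS hε
  rw [linearRisk, linearMinimaxRisk_ellipsoid_eq hμ hσ hS hε, ENNReal.toReal_ofReal hpos.le]
  exact ⟨hpos, sum_linear_risk_le hμ hS hε (le_maxAxis hlim)⟩

theorem linearMinimaxRisk_ellipsoid_ne_top {μ : ℕ → ℝ} (hμ : ∀ n, 0 ≤ μ n) (hne : ∃ n, μ n ≠ 0)
    (hlim : Tendsto μ atTop (𝓝 0)) {σ : ℝ} (hσ : 0 < σ) :
    linearMinimaxRisk σ (ellipsoid μ) ≠ ⊤ := fun h => by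
  have := (linearRisk_pos_and_le hμ hne hlim hσ).1
  rw [linearRisk, h] at this
  simp at this

theorem minimaxRisk_ellipsoid_ne_top {μ : ℕ → ℝ} (hμ : ∀ n, 0 ≤ μ n) (hne : ∃ n, μ n ≠ 0)
    (hlim : Tendsto μ atTop (𝓝 0)) {σ : ℝ} (hσ : 0 < σ) :
    minimaxRisk σ (ellipsoid μ) ≠ ⊤ :=
  ne_top_of_le_ne_top (linearMinimaxRisk_ellipsoid_ne_top hμ hne hlim hσ)
    (minimaxRisk_le_linearMinimaxRisk _ _)

theorem maxAxis_pos {μ : ℕ → ℝ} (hμ : ∀ n, 0 ≤ μ n) (hne : ∃ n, μ n ≠ 0)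
    (hlim : Tendsto μ atTop (𝓝 0)) : 0 < maxAxis μ := by
  obtain ⟨k, hk⟩ := hne
  exact ((hμ k).lt_of_ne' hk).trans_le (le_maxAxis hlim k)

theorem abs_risk_div_linearRisk_sub_one_le {μ : ℕ → ℝ} (hμ : ∀ n, 0 ≤ μ n) (hne : ∃ n, μ n ≠ 0)
    (hlim : Tendsto μ atTop (𝓝 0)) {σ : ℝ} (hσ : 0 < σ) :
    |risk μ σ / linearRisk μ σ - 1| ≤ 4 * √2 * σ / criticalRadius μ σ *
      √(lambertW (((1 + √3) * maxAxis μ ^ 2 * criticalRadius μ σ /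
        (√2 * σ * linearRisk μ σ)) ^ 2)) := by
  have hε := isCriticalRadius_criticalRadius hμ hne hlim hσ
  have hM0 := maxAxis_pos hμ hne hlim
  obtain ⟨hL, hLle⟩ := linearRisk_pos_and_le hμ hne hlim hσ
  have hRtop := minimaxRisk_ellipsoid_ne_top hμ hne hlim hσ
  have hLtop := linearMinimaxRisk_ellipsoid_ne_top hμ hne hlim hσ
  set ε := criticalRadius μ σ with hεdef
  have hε0 := hε.1
  have hfin : {n | ε < μ n}.Finite := finite_setOf_lt hlim hε.1
  have hS : ∀ n, n ∈ hfin.toFinset ↔ ε < μ n := fun n => by simp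
  have hLsum : linearRisk μ σ = ∑ n ∈ hfin.toFinset, σ ^ 2 * (1 - ε / μ n) := by
    rw [linearRisk, linearMinimaxRisk_ellipsoid_eq hμ hσ hS hε,
      ENNReal.toReal_ofReal (sum_linear_risk_pos hμ hσ hS hε).le]
  have hεM : ε ≤ maxAxis μ := by
    by_contra h
    have hempty : hfin.toFinset = ∅ := by
      ext n
      simpa using ((le_maxAxis hlim n).trans (not_le.1 h).le)
    rw [hLsum, hempty, Finset.sum_empty] at hL
    exact lt_irrefl _ hL
  have hz : (1 + √3) * maxAxis μ ^ 2 * ε / (√2 * σ * linearRisk μ σ) =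
      (1 + √3) * maxAxis μ ^ 2 * (ε / σ) / (√2 * linearRisk μ σ) := by
    field_simp
  have hc : 4 * √2 * σ / ε = 4 * √2 / (ε / σ) := by field_simp
  rw [hz, hc]
  obtain ⟨hW0, hW⟩ := lambertW_spec (sq_nonneg
    ((1 + √3) * maxAxis μ ^ 2 * (ε / σ) / (√2 * linearRisk μ σ)))
  refine abs_ratio_sub_one_le ENNReal.toReal_nonneg
    (ENNReal.toReal_mono hLtop (minimaxRisk_le_linearMinimaxRisk _ _)) hL
    (hLle.trans (by rw [sq]; gcongr)) (by positivity) hW0 hW fun η h0 h1 h2 => ?_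
  have h := shrunk_linear_risk_le_minimaxRisk hμ hσ hS hε hM0 (le_maxAxis hlim) h0 h1 h2
  rw [← hLsum, ← ENNReal.ofReal_toReal hRtop, ← ENNReal.ofReal_add ENNReal.toReal_nonneg
    (by positivity)] at h
  exact (ENNReal.ofReal_le_ofReal_iff
    (add_nonneg ENNReal.toReal_nonneg (by positivity))).1 h

theorem tendsto_vScale {μ : ℕ → ℝ} (hμ : ∀ n, 0 ≤ μ n) (hne : ∃ n, μ n ≠ 0)
    (hlim : Tendsto μ atTop (𝓝 0)) : Tendsto (vScale μ) (𝓝[>] 0) atTop := by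
  have hM0 := maxAxis_pos hμ hne hlim
  refine tendsto_atTop_mono' _ ?_ (tendsto_inv_nhdsGT_zero.const_mul_atTop (inv_pos.2 hM0))
  filter_upwards [self_mem_nhdsWithin] with σ (hσ : 0 < σ)
  obtain ⟨hL, hLle⟩ := linearRisk_pos_and_le hμ hne hlim hσ
  rw [vScale, le_div_iff₀ (by positivity)]
  calc (maxAxis μ)⁻¹ * σ⁻¹ * (σ * linearRisk μ σ) = (maxAxis μ)⁻¹ * linearRisk μ σ := by
        field_simp
    _ ≤ (maxAxis μ)⁻¹ * (maxAxis μ * criticalRadius μ σ) := by gcongr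
    _ = criticalRadius μ σ := by field_simp

theorem risk_sub_linearRisk_isBigO {μ : ℕ → ℝ} (hμ : ∀ n, 0 ≤ μ n) (hne : ∃ n, μ n ≠ 0)
    (hlim : Tendsto μ atTop (𝓝 0)) :
    (fun σ => risk μ σ - linearRisk μ σ) =O[𝓝[>] 0]
      fun σ => √(Real.log (vScale μ σ)) / vScale μ σ := by
  have hM0 := maxAxis_pos hμ hne hlim
  have hv := tendsto_vScale hμ hne hlim
  set C := (1 + √3) * maxAxis μ ^ 2 / √2 with hC
  have hC0 : 0 < C := by positivity
  refine IsBigO.of_bound (4 * √2 * 2) ?_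
  filter_upwards [self_mem_nhdsWithin, hv.eventually_ge_atTop C, hv.eventually_ge_atTop 1,
    hv.eventually_ge_atTop (Real.exp 1 / C)] with σ (hσ : 0 < σ) hvC hv1 hve
  have hL := (linearRisk_pos_and_le hμ hne hlim hσ).1
  have hε0 := (isCriticalRadius_criticalRadius hμ hne hlim hσ).1
  have hmain := abs_risk_div_linearRisk_sub_one_le hμ hne hlim hσ
  have harg : (1 + √3) * maxAxis μ ^ 2 * criticalRadius μ σ / (√2 * σ * linearRisk μ σ) =
      C * vScale μ σ := by
    rw [hC, vScale]; field_simp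
  rw [harg] at hmain
  set v := vScale μ σ with hvdef
  have hv0 : 0 < v := by linarith
  have hCv : Real.exp 1 ≤ C * v := by rwa [div_le_iff₀' hC0] at hve
  have hCv1 : 1 ≤ C * v := (Real.one_le_exp zero_le_one).trans hCv
  have hW : lambertW ((C * v) ^ 2) ≤ 2 ^ 2 * Real.log v := by
    calc lambertW ((C * v) ^ 2) ≤ Real.log ((C * v) ^ 2) :=
          lambertW_le_log (hCv.trans (by nlinarith))
      _ ≤ Real.log (v ^ 4) := by
          apply Real.log_le_log (by positivity)
          calc (C * v) ^ 2 ≤ (v * v) ^ 2 := by gcongr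
            _ = v ^ 4 := by ring
      _ = 2 ^ 2 * Real.log v := by rw [Real.log_pow]; norm_num
  have hsq : √(lambertW ((C * v) ^ 2)) ≤ 2 * √(Real.log v) := by
    refine (Real.sqrt_le_sqrt hW).trans_eq ?_
    rw [Real.sqrt_mul (by positivity), Real.sqrt_sq (by norm_num)]
  have hdiff : risk μ σ - linearRisk μ σ = linearRisk μ σ * (risk μ σ / linearRisk μ σ - 1) := by
    field_simp
  have hscale : linearRisk μ σ * (4 * √2 * σ / criticalRadius μ σ) = 4 * √2 / v := by
    rw [hvdef, vScale]; field_simp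
  rw [Real.norm_eq_abs, Real.norm_of_nonneg (by positivity), hdiff, abs_mul, abs_of_pos hL]
  calc linearRisk μ σ * |risk μ σ / linearRisk μ σ - 1|
      ≤ linearRisk μ σ * (4 * √2 * σ / criticalRadius μ σ * √(lambertW ((C * v) ^ 2))) := by
        gcongr
    _ = 4 * √2 / v * √(lambertW ((C * v) ^ 2)) := by rw [← mul_assoc, hscale]
    _ ≤ 4 * √2 / v * (2 * √(Real.log v)) := by gcongr
    _ = 4 * √2 * 2 * (√(Real.log v) / v) := by ring

end EllipsoidRisk

theorem theorem3 (μ : ℕ → ℝ) (hμ_nonneg : ∀ n, 0 ≤ μ n) (hμ_ne : ∃ n, μ n ≠ 0)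
    (hμ_lim : Filter.Tendsto μ Filter.atTop (nhds 0)) :
    (∀ σ : ℝ, 0 < σ →
      (∃! ε : ℝ, EllipsoidRisk.IsCriticalRadius μ σ ε) ∧
      EllipsoidRisk.minimaxRisk σ (EllipsoidRisk.ellipsoid μ) ≠ ⊤ ∧
      EllipsoidRisk.linearMinimaxRisk σ (EllipsoidRisk.ellipsoid μ) ≠ ⊤ ∧
      0 < EllipsoidRisk.linearRisk μ σ ∧
      |EllipsoidRisk.risk μ σ / EllipsoidRisk.linearRisk μ σ - 1| ≤
        4 * √2 * σ / EllipsoidRisk.criticalRadius μ σ *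
          √(EllipsoidRisk.lambertW
            (((1 + √3) * EllipsoidRisk.maxAxis μ ^ 2 * EllipsoidRisk.criticalRadius μ σ /
              (√2 * σ * EllipsoidRisk.linearRisk μ σ)) ^ 2))) ∧
    Filter.Tendsto (EllipsoidRisk.vScale μ) (nhdsWithin 0 (Set.Ioi 0)) Filter.atTop ∧
    (fun σ : ℝ => EllipsoidRisk.risk μ σ - EllipsoidRisk.linearRisk μ σ)
      =O[nhdsWithin 0 (Set.Ioi 0)]
        (fun σ : ℝ => √(Real.log (EllipsoidRisk.vScale μ σ)) / EllipsoidRisk.vScale μ σ) := by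
  exact ⟨fun σ hσ => ⟨EllipsoidRisk.existsUnique_isCriticalRadius hμ_nonneg hμ_ne hμ_lim hσ,
      EllipsoidRisk.minimaxRisk_ellipsoid_ne_top hμ_nonneg hμ_ne hμ_lim hσ,
      EllipsoidRisk.linearMinimaxRisk_ellipsoid_ne_top hμ_nonneg hμ_ne hμ_lim hσ,
      (EllipsoidRisk.linearRisk_pos_and_le hμ_nonneg hμ_ne hμ_lim hσ).1,
      EllipsoidRisk.abs_risk_div_linearRisk_sub_one_le hμ_nonneg hμ_ne hμ_lim hσ⟩,
    EllipsoidRisk.tendsto_vScale hμ_nonneg hμ_ne hμ_lim,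
    EllipsoidRisk.risk_sub_linearRisk_isBigO hμ_nonneg hμ_ne hμ_lim⟩
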